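/- Let $n\in\mathbb N$, let $\widehat\Sigma\in\mathbb R^{n\times n}$ be symmetric positive definite, and let $\varepsilon\in\mathbb R$. For a symmetric positive semidefinite $\Sigma$ let $$\mathrm{KL}(\Sigma\|\widehat\Sigma)=\tfrac12\bigl(-\log\det\Sigma+\log\det\widehat\Sigma+\mathrm{Tr}(\Sigma\widehat\Sigma^{-1})-n\bigr)$$ (with value $+\infty$ if $\Sigma$ is singular), and let $B_\varepsilon=\{\Sigma\succeq0:\mathrm{KL}(\Sigma\|\widehat\Sigma)\le\varepsilon\}$. Write $\langle A,B\rangle=\mathrm{Tr}(A^\top B)$, $\|A\|_F=\sqrt{\langle A,A\rangle}$, $\|\cdot\|_*$ for the nuclear norm (the sum of the singular values) and $\lambda_{\max}$ for the largest eigenvalue of a symmetric matrix. For $\gamma>0$ put $\Sigma^\star(\Lambda,\gamma)=\bigl(\widehat\Sigma^{-1}+\tfrac2\gamma\Lambda\bigr)^{-1}$. (i) (Closed-form oracle.) Suppose $\varepsilon>0$ and let $\Lambda\ne0$ be a symmetric $n\times n$ matrix. There is exactly one scalar $\gamma^\star>\max\{0,\,2\lambda_{\max}(-\widehat\Sigma^{1/2}\Lambda\widehat\Sigma^{1/2})\}$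 with $\mathrm{KL}(\Sigma^\star(\Lambda,\gamma^\star)\|\widehat\Sigma)=\varepsilon$. It satisfies $$\gamma^\star\le\bigl\|\widehat\Sigma^{1/2}\Lambda\widehat\Sigma^{1/2}\bigr\|_*\cdot\begin{cases}\sqrt{6/\varepsilon}, & \varepsilon\le\frac1{24},\\[2pt] 6+\frac1{4\varepsilon}, & \varepsilon>\frac1{24},\end{cases}$$ and the linear minimization oracle is $\arg\min_{\Sigma\in B_\varepsilon}\langle\Lambda,\Sigma\rangle=\{\Sigma^\star(\Lambda,\gamma^\star)\}$. (ii) (Lipschitz constant.) Suppose $\varepsilon\ge0$. For every symmetric $\Lambda$ the minimum $d(\Lambda)=\min_{\Sigma\in B_\varepsilon}\langle\Lambda,\Sigma\rangle$ is attained, the maximum $\mathcal L=\max_{\Sigma\in B_\varepsilon}\|\Sigma\|_F$ is attained, $|d(\Lambda_1)-d(\Lambda_2)|\le\mathcal L\,\|\Lambda_1-\Lambda_2\|_F$ for all symmetric $\Lambda_1,\Lambda_2$, and $$\mathcal L\le\bigl(n\,r(\varepsilon)+1\bigr)\|\widehat\Sigma\|_F,\qquad r(\varepsilon)=\begin{cases}\sqrt{6\varepsilon},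 & \varepsilon\le\frac1{24},\\[2pt] 6\varepsilon+\frac14, & \varepsilon>\frac1{24}.\end{cases}$$ -/

import Mathlib

open scoped Matrix MatrixOrder

noncomputable section

namespace FactorModel

/-- Real square matrices of size `n`. -/
abbrev Mat (n : ℕ) := Matrix (Fin n) (Fin n) ℝ

variable {n : ℕ}

/-- The inner product `⟨A, B⟩ = Tr (Aᵀ B)`. -/
def frobInner (A B : Mat n) : ℝ := (Aᵀ * B).trace

/-- The Frobenius norm, `‖A‖_F ^ 2 = ⟨A, A⟩`. -/
def frobNorm (A : Mat n) : ℝ := √(frobInner A A)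

/-- The positive semidefinite square root of a positive semidefinite matrix. -/
def psdSqrt (A : Mat n) : Mat n := CFC.sqrt A

/-- The nuclear norm `‖A‖_* = Tr ((Aᵀ A)^{1/2})`, the sum of the singular values of `A`. -/
def nuclearNorm (A : Mat n) : ℝ := (psdSqrt (Aᵀ * A)).trace

/-- The largest eigenvalue of a symmetric matrix (of positive size). -/
def lambdaMax (A : Mat n) : ℝ := sSup (spectrum ℝ A)

/-- The ball `{Σ ⪰ 0 : d(Σ, Σ₀) ≤ ε}` of an extended-real-valued distance function `d`. -/
def ball (d : Mat n → Mat n → EReal) (S₀ : Mat n) (ε : ℝ) : Set (Mat n) :=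
  {S | S.PosSemidef ∧ d S S₀ ≤ (ε : EReal)}

/-- The linear minimization oracle: the set of all minimizers of `⟨Λ, Σ⟩` over the ball. -/
def lmo (d : Mat n → Mat n → EReal) (S₀ : Mat n) (ε : ℝ) (L : Mat n) : Set (Mat n) :=
  {S | S ∈ ball d S₀ ε ∧ ∀ T ∈ ball d S₀ ε, frobInner L S ≤ frobInner L T}

/-- The dual function: the minimal value of `⟨Λ, Σ⟩` over the ball. -/
def dualFun (d : Mat n → Mat n → EReal) (S₀ : Mat n) (ε : ℝ) (L : Mat n) : ℝ :=
  sInf (frobInner L '' ball d S₀ ε)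

/-- The constant `max ‖Σ‖_F` over the ball. -/
def lipConst (d : Mat n → Mat n → EReal) (S₀ : Mat n) (ε : ℝ) : ℝ :=
  sSup (frobNorm '' ball d S₀ ε)

open scoped Classical in
/-- The Kullback-Leibler divergence of the centred Gaussians with covariance matrices `S` and
`S₀` (`S₀` positive definite). For a singular positive semidefinite `S` the term
`- log det S` is `+∞`, whence the value `⊤`. -/
def gaussianKL (S S₀ : Mat n) : EReal :=
  if S.PosDef then
    (((1 / 2 : ℝ) * (-Real.log S.det + Real.log S₀.det + (S * S₀⁻¹).trace - (n : ℝ)) : ℝ) : EReal)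
  else ⊤

/-- The matrix `Σ⋆(Λ, γ) = (Σ₀⁻¹ + (2 / γ) Λ)⁻¹`. -/
def klOracle (S₀ L : Mat n) (γ : ℝ) : Mat n := (S₀⁻¹ + (2 / γ) • L)⁻¹

/-- The congruence `Σ₀^{1/2} Λ Σ₀^{1/2}`. -/
def sqrtCongr (S₀ L : Mat n) : Mat n := psdSqrt S₀ * L * psdSqrt S₀

end FactorModel

end

namespace FactorModel

/-! ### Scalar inequalities -/

/-! Whitening `Σ = S₀^{1/2} Y S₀^{1/2}` turns the divergence into `½ ∑ (yᵢ - 1 - log yᵢ)` over the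
eigenvalues of `Y` (`klReal_sqrtCongr_eq_sum`).

Oracle: if `K⁻¹ = S₀⁻¹ + (2/γ) L`, then `KL(T‖S₀) + γ⁻¹⟨L, T⟩` equals a constant plus `KL(T‖K)`
(`klReal_add_frobInner`). Hence `K` is the unique minimizer as soon as it lies on the boundary
`KL(K‖S₀) = ε`. With `s = 2/γ` and `μ` the eigenvalues of the whitened `L`, this boundary equation
is `scaleKL μ s = ε`. Its left side is continuous and strictly increasing while all `1 + s μᵢ > 0`,
and it reaches `ε`, so there is one root. At an explicit `s₀` it is still at most `ε`, so `s ≥ s₀`,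
which is the upper bound on `γ`.

Lipschitz constant: each `yᵢ ≤ 1 + r(ε)`, so the ball lies below `(1 + r(ε)) S₀` in the Loewner
order, and the Frobenius norm is monotone on the positive semidefinite cone. The ball is therefore
compact; Cauchy–Schwarz at a minimizer does the rest. -/

/-- The function `t ↦ log (1 + t) - t / (1 + t)`, twice the contribution of an eigenvalue
`1 / (1 + t)` to the Kullback-Leibler divergence. -/
noncomputable def resolventKL (t : ℝ) : ℝ := Real.log (1 + t) + (1 + t)⁻¹ - 1

lemma resolventKL_le {t : ℝ} (ht : 0 < 1 + t) : resolventKL t ≤ t ^ 2 / (1 + t) := by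
  have h := Real.log_le_sub_one_of_pos ht
  have e : t ^ 2 / (1 + t) = (1 + t) - 1 + (1 + t)⁻¹ - 1 := by field_simp; ring
  rw [e, resolventKL]; linarith

lemma resolventKL_nonneg {t : ℝ} (ht : 0 < 1 + t) : 0 ≤ resolventKL t := by
  have h := Real.log_le_sub_one_of_pos (inv_pos.2 ht)
  rw [Real.log_inv] at h
  rw [resolventKL]; linarith

lemma one_add_mul_pos_of_le {a b μ : ℝ} (ha : 0 < a) (hab : a ≤ b) (h : 0 < 1 + b * μ) :
    0 < 1 + a * μ := by
  rcases le_or_gt 0 μ with hμ | hμ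
  · positivity
  · nlinarith

/-- Bounding `log (p / q)` by `p / q - 1`, with `p = 1 + aμ` and `q = 1 + bμ`, leaves the sign of
`(q - p)(p - 1) = (b - a) a μ²`, positive for either sign of `μ`. -/
lemma resolventKL_mul_lt {a b μ : ℝ} (ha : 0 < a) (hab : a < b) (hμ : μ ≠ 0)
    (hb : 0 < 1 + b * μ) : resolventKL (a * μ) < resolventKL (b * μ) := by
  have hp := one_add_mul_pos_of_le ha hab.le hb
  have h := Real.log_le_sub_one_of_pos (div_pos hp hb)
  rw [Real.log_div hp.ne' hb.ne'] at h
  have key : 0 < (1 - (1 + a * μ) / (1 + b * μ)) + (1 + b * μ)⁻¹ - (1 + a * μ)⁻¹ := by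
    have e : ∀ p q : ℝ, 0 < p → 0 < q →
        (1 - p / q) + q⁻¹ - p⁻¹ = (q - p) * (p - 1) / (p * q) := by
      intro p q hp hq
      field_simp
      ring
    rw [e _ _ hp hb, show (1 + b * μ - (1 + a * μ)) * (1 + a * μ - 1) = (b - a) * a * μ ^ 2 by ring]
    have : 0 < b - a := sub_pos.2 hab
    positivity
  rw [resolventKL, resolventKL]; linarith

lemma log_one_add_le_sub_sq_div {x : ℝ} (h0 : 0 ≤ x) (h1 : x ≤ 1 / 2) :
    Real.log (1 + x) ≤ x - x ^ 2 / 3 := by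
  have hu : 0 ≤ x - x ^ 2 / 3 := by nlinarith
  rw [Real.log_le_iff_le_exp (by linarith)]
  refine le_trans ?_ (Real.quadratic_le_exp_of_nonneg hu)
  -- With `u = x - x²/3`, the goal `1 + x ≤ 1 + u + u²/2` is `x²/3 ≤ x²(1 - x/3)²/2`; at `x = 1/2`
  -- the square is `25/36`.
  have : 2 / 3 ≤ (1 - x / 3) ^ 2 := by nlinarith
  nlinarith [mul_nonneg (sq_nonneg x) (sub_nonneg.2 this)]

/-- The tangent line at `x = 1/2`, with `log (3/2) ≤ 5/12` from the quadratic bound. -/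
lemma log_one_add_le_affine {x : ℝ} (h : -1 < x) :
    Real.log (1 + x) ≤ 2 / 3 * x + 1 / 12 := by
  have h1 := log_one_add_le_sub_sq_div (x := 1 / 2) (by norm_num) (by norm_num)
  have hx : 0 < 1 + x := by linarith
  have h2 := Real.log_le_sub_one_of_pos (div_pos hx (by norm_num : (0 : ℝ) < 1 + 1 / 2))
  rw [Real.log_div hx.ne' (by norm_num),
    show (1 + x) / (1 + 1 / 2) = 2 / 3 * (1 + x) by ring] at h2
  linarith

/-- The radius function in the bound on the Lipschitz constant. -/
noncomputable def klRadius (ε : ℝ) : ℝ := if ε ≤ 1 / 24 then √(6 * ε) else 6 * ε + 1 / 4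

lemma klRadius_nonneg (ε : ℝ) : 0 ≤ klRadius ε := by
  unfold klRadius
  split_ifs with h
  · positivity
  · linarith

/-- For `x = y - 1`, the quadratic bound gives `x² ≤ 6ε` when `0 < x ≤ 1/2`, and the affine one
gives `x ≤ 6ε + 1/4`. Both radii equal `1/2` at `ε = 1/24`, so `x > 1/2` excludes the first branch.
-/
lemma le_one_add_klRadius {y ε : ℝ} (hy : 0 < y) (h : y - 1 - Real.log y ≤ 2 * ε) :
    y ≤ 1 + klRadius ε := by
  obtain ⟨x, rfl⟩ : ∃ x, y = 1 + x := ⟨y - 1, by ring⟩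
  rcases le_or_gt x 0 with h0 | h0
  · linarith [klRadius_nonneg ε]
  have ha := log_one_add_le_affine (x := x) (by linarith)
  unfold klRadius
  rcases le_or_gt x (1 / 2) with h1 | h1
  · have hq := log_one_add_le_sub_sq_div h0.le h1
    split_ifs with hε
    · have : x ≤ √(6 * ε) := Real.le_sqrt_of_sq_le (by linarith)
      linarith
    · linarith
  · split_ifs with hε
    · linarith
    · linarith

/-! ### The scalar equation for the multiplier -/

section Scale

variable {ι : Type*} [Fintype ι]

/-- Half the sum of `resolventKL (s * μ i)`. -/
noncomputable def scaleKL (μ : ι → ℝ) (s : ℝ) : ℝ := (1 / 2) * ∑ i, resolventKL (s * μ i)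

lemma scaleKL_lt {μ : ι → ℝ} (hμ : μ ≠ 0) {a b : ℝ} (ha : 0 < a) (hab : a < b)
    (hb : ∀ i, 0 < 1 + b * μ i) : scaleKL μ a < scaleKL μ b := by
  obtain ⟨j, hj⟩ := Function.ne_iff.1 hμ
  unfold scaleKL
  refine mul_lt_mul_of_pos_left (Finset.sum_lt_sum (fun i _ => ?_) ⟨j, Finset.mem_univ j, ?_⟩)
    (by norm_num)
  · by_cases h : μ i = 0
    · simp [h]
    · exact (resolventKL_mul_lt ha hab h (hb i)).le
  · exact resolventKL_mul_lt ha hab hj (hb j)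

lemma continuousOn_scaleKL {μ : ι → ℝ} {a b : ℝ} (ha : 0 < a) (hb : ∀ i, 0 < 1 + b * μ i) :
    ContinuousOn (scaleKL μ) (Set.Icc a b) := by
  unfold scaleKL resolventKL
  refine continuousOn_const.mul (continuousOn_finsetSum _ fun i _ => ?_)
  have hne : ∀ s ∈ Set.Icc a b, 1 + s * μ i ≠ 0 := fun s hs =>
    (one_add_mul_pos_of_le (ha.trans_le hs.1) hs.2 (hb i)).ne'
  exact ((ContinuousOn.log (by fun_prop) hne).add (ContinuousOn.inv₀ (by fun_prop) hne)).sub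
    continuousOn_const

lemma exists_le_scaleKL {μ : ι → ℝ} (hμ : μ ≠ 0) {ε : ℝ} (hε : 0 < ε) :
    ∃ s, 0 < s ∧ (∀ i, 0 < 1 + s * μ i) ∧ ε ≤ scaleKL μ s := by
  obtain ⟨j, hj⟩ := Function.ne_iff.1 hμ
  have single : ∀ s, (∀ i, 0 < 1 + s * μ i) → ∀ k, 2 * ε ≤ resolventKL (s * μ k) →
      ε ≤ scaleKL μ s := by
    intro s hs k hk
    have := Finset.single_le_sum (f := fun i => resolventKL (s * μ i))
      (fun i _ => resolventKL_nonneg (hs i)) (Finset.mem_univ k)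
    unfold scaleKL; linarith
  have : Nonempty ι := ⟨j⟩
  obtain ⟨m, hm⟩ := Finite.exists_min μ
  rcases lt_or_ge (μ m) 0 with h | h
  · have hv : 1 < (2 + 2 * ε) ^ 2 := by nlinarith
    have hv' : ((2 + 2 * ε) ^ 2)⁻¹ < 1 := inv_lt_one_of_one_lt₀ hv
    -- Near the pole `-1 / μ m` the inverse dominates the logarithm: for `1 + s μ m = a⁻²` the term
    -- is `a² - 1 - 2 log a`, and `a = 2 + 2ε` makes it exceed `2ε`.
    set s := (1 - ((2 + 2 * ε) ^ 2)⁻¹) / (-μ m) with hsdef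
    have hs : 0 < s := div_pos (by linarith) (by linarith)
    have hsm : 1 + s * μ m = ((2 + 2 * ε) ^ 2)⁻¹ := by
      have : s * (-μ m) = 1 - ((2 + 2 * ε) ^ 2)⁻¹ := div_mul_cancel₀ _ (by linarith)
      linarith
    have hpos : ∀ i, 0 < 1 + s * μ i := fun i => by
      have h1 : 0 < 1 + s * μ m := by rw [hsm]; positivity
      have h2 := mul_le_mul_of_nonneg_left (hm i) hs.le
      linarith
    refine ⟨s, hs, hpos, single s hpos m ?_⟩
    have hl := Real.log_le_sub_one_of_pos (by linarith : 0 < 2 + 2 * ε)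
    rw [resolventKL, hsm, inv_inv, Real.log_inv, Real.log_pow]
    push_cast
    nlinarith
  · have hμj : 0 < μ j := lt_of_le_of_ne (h.trans (hm j)) (Ne.symm hj)
    -- Without negative `μ i` every `s > 0` is admissible, and the logarithm alone makes the `j`
    -- term large.
    have hs : 0 < Real.exp (2 * ε + 1) / μ j := by positivity
    have hpos : ∀ i, 0 < 1 + Real.exp (2 * ε + 1) / μ j * μ i := fun i => by
      have := mul_nonneg hs.le (h.trans (hm i)); linarith
    refine ⟨_, hs, hpos, single _ hpos j ?_⟩
    rw [div_mul_cancel₀ _ hμj.ne', resolventKL]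
    have h1 : 2 * ε + 1 ≤ Real.log (1 + Real.exp (2 * ε + 1)) := by
      rw [Real.le_log_iff_exp_le (by positivity)]; linarith
    have : 0 < (1 + Real.exp (2 * ε + 1))⁻¹ := by positivity
    linarith

lemma exists_scaleKL_eq {μ : ι → ℝ} (hμ : μ ≠ 0) {ε s₀ : ℝ} (hε : 0 < ε) (hs₀ : 0 < s₀)
    (hadm : ∀ i, 0 < 1 + s₀ * μ i) (hle : scaleKL μ s₀ ≤ ε) :
    ∃ s, s₀ ≤ s ∧ (∀ i, 0 < 1 + s * μ i) ∧ scaleKL μ s = ε := by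
  obtain ⟨s₁, h1, hadm1, hle1⟩ := exists_le_scaleKL hμ hε
  have h01 : s₀ ≤ s₁ := by
    by_contra! hlt
    linarith [scaleKL_lt hμ h1 hlt hadm]
  obtain ⟨s, hs, he⟩ := intermediate_value_Icc h01 (continuousOn_scaleKL hs₀ hadm1) ⟨hle, hle1⟩
  exact ⟨s, hs.1, fun i => one_add_mul_pos_of_le (hs₀.trans_le hs.1) hs.2 (hadm1 i), he⟩

/-- The factor in the bound on the multiplier. -/
noncomputable def multiplierFactor (ε : ℝ) : ℝ := if ε ≤ 1 / 24 then √(6 / ε) else 6 + 1 / (4 * ε)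

/-- The second inequality is exactly `4 / (c (c - 2)) ≤ 2ε`, the form needed to bound `scaleKL` at
`2 / (N c)`. -/
lemma multiplierFactor_bounds {ε : ℝ} (hε : 0 < ε) :
    6 ≤ multiplierFactor ε ∧ 2 ≤ ε * (multiplierFactor ε * (multiplierFactor ε - 2)) := by
  unfold multiplierFactor
  split_ifs with h
  · have hsq : √(6 / ε) * √(6 / ε) = 6 / ε := Real.mul_self_sqrt (by positivity)
    have h12 : 12 ≤ √(6 / ε) := by
      apply Real.le_sqrt_of_sq_le
      rw [le_div_iff₀ hε]; linarith
    have h6 : ε * (6 / ε) = 6 := by field_simp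
    have hc : 3 * √(6 / ε) ≤ √(6 / ε) * √(6 / ε) := by nlinarith
    have := mul_le_mul_of_nonneg_left hc hε.le
    have e : ε * (√(6 / ε) * (√(6 / ε) - 2)) = ε * (√(6 / ε) * √(6 / ε)) - 2 * (ε * √(6 / ε)) := by
      ring
    rw [e, hsq, h6]
    rw [hsq, h6] at this
    exact ⟨by linarith, by linarith⟩
  · have hd : 0 < 1 / (4 * ε) := by positivity
    refine ⟨by linarith, ?_⟩
    have e : ε * ((6 + 1 / (4 * ε)) * (6 + 1 / (4 * ε) - 2))
        = 24 * ε + 5 / 2 + 1 / 4 * (1 / (4 * ε)) := by field_simp; ring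
    rw [e]; linarith

lemma sum_abs_pos {μ : ι → ℝ} (hμ : μ ≠ 0) : 0 < ∑ i, |μ i| := by
  obtain ⟨j, hj⟩ := Function.ne_iff.1 hμ
  exact Finset.sum_pos' (fun i _ => abs_nonneg _) ⟨j, Finset.mem_univ j, abs_pos.2 hj⟩

/-- Every `t = s μᵢ` satisfies `|t| ≤ 2/c < 1`, so `t² / (1 + t) ≤ 2/(c - 2) · |t|`, and the `|t|`
sum to `2/c`. -/
lemma scaleKL_le_of_multiplierFactor {μ : ι → ℝ} (hμ : μ ≠ 0) {ε : ℝ} (hε : 0 < ε) :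
    (∀ i, 0 < 1 + 2 / ((∑ i, |μ i|) * multiplierFactor ε) * μ i) ∧
      scaleKL μ (2 / ((∑ i, |μ i|) * multiplierFactor ε)) ≤ ε := by
  obtain ⟨hc, hcε⟩ := multiplierFactor_bounds hε
  set c := multiplierFactor ε
  have hN := sum_abs_pos hμ
  set N := ∑ i, |μ i| with hNdef
  have hcpos : 0 < c := by linarith
  have hs : 0 < 2 / (N * c) := by positivity
  set s := 2 / (N * c) with hsdef
  have hsN : s * N = 2 / c := by rw [hsdef]; field_simp
  have hle : ∀ i, |s * μ i| ≤ 2 / c := fun i => by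
    rw [abs_mul, abs_of_pos hs, ← hsN]
    exact mul_le_mul_of_nonneg_left
      (Finset.single_le_sum (fun i _ => abs_nonneg (μ i)) (Finset.mem_univ i)) hs.le
  have hc1 : 2 / c < 1 := by rw [div_lt_one hcpos]; linarith
  have hpos : ∀ i, 0 < 1 + s * μ i := fun i => by
    have := (abs_le.1 (hle i)).1; linarith
  refine ⟨hpos, ?_⟩
  have hterm : ∀ i, resolventKL (s * μ i) ≤ (2 / (c - 2)) * (s * |μ i|) := fun i => by
    refine (resolventKL_le (hpos i)).trans ?_
    have hd : 0 < 1 - 2 / c := by linarith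
    have hlow : 1 - 2 / c ≤ 1 + s * μ i := by
      have := (abs_le.1 (hle i)).1; linarith
    have e : (2 / (c - 2)) * (s * |μ i|) = (2 / c * (s * |μ i|)) / (1 - 2 / c) := by
      have : c - 2 ≠ 0 := by linarith
      field_simp
    rw [e]
    refine div_le_div₀ (by positivity) ?_ hd hlow
    have h2 : (s * μ i) ^ 2 = |s * μ i| * |s * μ i| := by rw [← sq, sq_abs]
    rw [h2]
    have h3 : |s * μ i| = s * |μ i| := by rw [abs_mul, abs_of_pos hs]
    calc |s * μ i| * |s * μ i| ≤ 2 / c * |s * μ i| :=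
          mul_le_mul_of_nonneg_right (hle i) (abs_nonneg _)
      _ = _ := by rw [h3]
  have hsum : ∑ i, resolventKL (s * μ i) ≤ (2 / (c - 2)) * (2 / c) := by
    refine (Finset.sum_le_sum fun i _ => hterm i).trans_eq ?_
    rw [← Finset.mul_sum, ← Finset.mul_sum, ← hNdef, hsN]
  have hfin : (2 / (c - 2)) * (2 / c) ≤ 2 * ε := by
    have : 0 < c - 2 := by linarith
    rw [div_mul_div_comm, div_le_iff₀ (by positivity)]
    linarith
  unfold scaleKL
  linarith

end Scale

variable {n : ℕ}

/-! ### Spectral decomposition of symmetric matrices -/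

/-- The matrix with the eigenvectors of `M` and the eigenvalues `f`. -/
noncomputable def spectralConj {M : Mat n} (hM : M.IsHermitian) (f : Fin n → ℝ) : Mat n :=
  Unitary.conjStarAlgAut ℝ (Mat n) hM.eigenvectorUnitary (Matrix.diagonal f)

section Spectral

variable {M : Mat n} (hM : M.IsHermitian)

lemma spectralConj_eigenvalues : spectralConj hM hM.eigenvalues = M := by
  conv_rhs => rw [hM.spectral_theorem]
  rfl

lemma spectralConj_mul (f g : Fin n → ℝ) :
    spectralConj hM f * spectralConj hM g = spectralConj hM (f * g) := by
  unfold spectralConj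
  rw [← map_mul, Matrix.diagonal_mul_diagonal]
  rfl

lemma spectralConj_one : spectralConj hM 1 = 1 := by
  unfold spectralConj
  rw [show Matrix.diagonal (1 : Fin n → ℝ) = 1 from Matrix.diagonal_one, map_one]

lemma spectralConj_add (f g : Fin n → ℝ) :
    spectralConj hM (f + g) = spectralConj hM f + spectralConj hM g := by
  unfold spectralConj
  rw [← map_add, Matrix.diagonal_add]
  rfl

lemma spectralConj_smul (c : ℝ) (f : Fin n → ℝ) :
    spectralConj hM (c • f) = c • spectralConj hM f := by
  unfold spectralConj
  rw [← map_smul, Matrix.diagonal_smul]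

lemma spectralConj_eq (f : Fin n → ℝ) : spectralConj hM f =
    (hM.eigenvectorUnitary : Mat n) * Matrix.diagonal f * star (hM.eigenvectorUnitary : Mat n) :=
  Unitary.conjStarAlgAut_apply _ _

lemma trace_spectralConj (f : Fin n → ℝ) : (spectralConj hM f).trace = ∑ i, f i := by
  rw [spectralConj_eq, Matrix.trace_mul_cycle, Unitary.coe_star_mul_self, one_mul,
    Matrix.trace_diagonal]

lemma det_spectralConj (f : Fin n → ℝ) : (spectralConj hM f).det = ∏ i, f i := by
  rw [spectralConj_eq, Matrix.det_mul_comm, ← mul_assoc, Unitary.coe_star_mul_self, one_mul,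
    Matrix.det_diagonal]

lemma posSemidef_spectralConj_iff (f : Fin n → ℝ) :
    (spectralConj hM f).PosSemidef ↔ ∀ i, 0 ≤ f i := by
  rw [spectralConj_eq, Matrix.IsUnit.posSemidef_star_right_conjugate_iff Unitary.isUnit_coe,
    Matrix.posSemidef_diagonal_iff]

lemma posDef_spectralConj_iff (f : Fin n → ℝ) :
    (spectralConj hM f).PosDef ↔ ∀ i, 0 < f i := by
  rw [spectralConj_eq, Matrix.IsUnit.posDef_star_right_conjugate_iff Unitary.isUnit_coe,
    Matrix.posDef_diagonal_iff]

lemma spectralConj_one_add_smul (s : ℝ) :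
    spectralConj hM (fun i => 1 + s * hM.eigenvalues i) = 1 + s • M := by
  have : (fun i => 1 + s * hM.eigenvalues i) = 1 + s • hM.eigenvalues := by
    ext i; simp
  rw [this, spectralConj_add, spectralConj_one, spectralConj_smul, spectralConj_eigenvalues]

end Spectral

lemma nuclearNorm_eq_sum_abs {M : Mat n} (hM : M.IsHermitian) :
    nuclearNorm M = ∑ i, |hM.eigenvalues i| := by
  have hsq : spectralConj hM (fun i => |hM.eigenvalues i|) *
      spectralConj hM (fun i => |hM.eigenvalues i|) = Mᵀ * M := by
    have hT : Mᵀ = M := by rw [← Matrix.conjTranspose_eq_transpose_of_trivial]; exact hM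
    have : (fun i => |hM.eigenvalues i|) * (fun i => |hM.eigenvalues i|)
        = hM.eigenvalues * hM.eigenvalues := by
      ext i; simp
    rw [hT, spectralConj_mul, this, ← spectralConj_mul, spectralConj_eigenvalues]
  have h0 : (0 : Mat n) ≤ spectralConj hM (fun i => |hM.eigenvalues i|) :=
    Matrix.nonneg_iff_posSemidef.2 ((posSemidef_spectralConj_iff hM _).2 fun i => abs_nonneg _)
  rw [nuclearNorm, psdSqrt, CFC.sqrt_unique hsq h0, trace_spectralConj]

/-- Translates the threshold on `γ` into the admissible range of the scalar equation, with `s =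
2/γ`. -/
lemma max_lambdaMax_neg_lt_iff [Nonempty (Fin n)] {M : Mat n} (hM : M.IsHermitian) {γ : ℝ} :
    max 0 (2 * lambdaMax (-M)) < γ ↔ 0 < γ ∧ ∀ i, 0 < 1 + 2 / γ * hM.eigenvalues i := by
  have hspec : spectrum ℝ (-M) = Set.range fun i => -hM.eigenvalues i := by
    rw [← spectrum.neg_eq, hM.spectrum_real_eq_range_eigenvalues]
    ext x
    simp [neg_eq_iff_eq_neg, eq_comm]
  rw [max_lt_iff]
  refine and_congr_right fun hγ => ?_
  have : 2 * lambdaMax (-M) < γ ↔ lambdaMax (-M) < γ / 2 := by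
    rw [lt_div_iff₀ (by norm_num), mul_comm]
  rw [this, lambdaMax, hspec, (Set.finite_range _).csSup_lt_iff (Set.range_nonempty _),
    Set.forall_mem_range]
  refine forall_congr' fun i => ?_
  have e : 1 + 2 / γ * hM.eigenvalues i = (2 / γ) * (γ / 2 + hM.eigenvalues i) := by
    field_simp
  rw [e, mul_pos_iff_of_pos_left (by positivity)]
  constructor <;> intro h <;> linarith

/-! ### The positive definite square root -/

section Root

lemma psdSqrt_mul_self {S : Mat n} (hS : S.PosSemidef) : psdSqrt S * psdSqrt S = S :=
  CFC.sqrt_mul_sqrt_self S (Matrix.nonneg_iff_posSemidef.2 hS)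

lemma posSemidef_psdSqrt (S : Mat n) : (psdSqrt S).PosSemidef :=
  Matrix.nonneg_iff_posSemidef.1 (CFC.sqrt_nonneg S)

lemma star_psdSqrt (S : Mat n) : star (psdSqrt S) = psdSqrt S :=
  (posSemidef_psdSqrt S).isHermitian

lemma isUnit_psdSqrt {S : Mat n} (hS : S.PosDef) : IsUnit (psdSqrt S) := by
  refine isUnit_of_mul_isUnit_left (y := psdSqrt S) ?_
  rw [psdSqrt_mul_self hS.posSemidef]
  exact hS.isUnit

lemma psdSqrt_mul_inv {S : Mat n} (hS : S.PosDef) : psdSqrt S * (psdSqrt S)⁻¹ = 1 :=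
  Matrix.mul_nonsing_inv _ ((Matrix.isUnit_iff_isUnit_det _).1 (isUnit_psdSqrt hS))

lemma psdSqrt_inv_mul {S : Mat n} (hS : S.PosDef) : (psdSqrt S)⁻¹ * psdSqrt S = 1 :=
  Matrix.nonsing_inv_mul _ ((Matrix.isUnit_iff_isUnit_det _).1 (isUnit_psdSqrt hS))

lemma inv_eq_psdSqrt_inv_mul {S : Mat n} (hS : S.PosDef) :
    S⁻¹ = (psdSqrt S)⁻¹ * (psdSqrt S)⁻¹ := by
  rw [← Matrix.mul_inv_rev, psdSqrt_mul_self hS.posSemidef]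

lemma posDef_sqrtCongr_iff {S Y : Mat n} (hS : S.PosDef) :
    (sqrtCongr S Y).PosDef ↔ Y.PosDef := by
  have := Matrix.IsUnit.posDef_star_right_conjugate_iff (x := Y) (isUnit_psdSqrt hS)
  rwa [star_psdSqrt] at this

lemma posSemidef_sqrtCongr_iff {S Y : Mat n} (hS : S.PosDef) :
    (sqrtCongr S Y).PosSemidef ↔ Y.PosSemidef := by
  have := Matrix.IsUnit.posSemidef_star_right_conjugate_iff (x := Y) (isUnit_psdSqrt hS)
  rwa [star_psdSqrt] at this

lemma isHermitian_sqrtCongr (S : Mat n) {Y : Mat n} (hY : Y.IsSymm) :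
    (sqrtCongr S Y).IsHermitian := by
  have h1 : (psdSqrt S)ᴴ = psdSqrt S := star_psdSqrt S
  have h2 : Yᴴ = Y := (Matrix.conjTranspose_eq_transpose_of_trivial Y).trans hY
  rw [Matrix.IsHermitian, sqrtCongr, Matrix.conjTranspose_mul, Matrix.conjTranspose_mul, h1, h2,
    mul_assoc]

lemma exists_sqrtCongr_eq {S : Mat n} (hS : S.PosDef) (T : Mat n) :
    ∃ Y, sqrtCongr S Y = T := by
  refine ⟨(psdSqrt S)⁻¹ * T * (psdSqrt S)⁻¹, ?_⟩
  rw [sqrtCongr, ← mul_assoc, ← mul_assoc, psdSqrt_mul_inv hS, one_mul, mul_assoc,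
    psdSqrt_inv_mul hS, mul_one]

lemma sqrtCongr_one {S : Mat n} (hS : S.PosDef) : sqrtCongr S 1 = S := by
  rw [sqrtCongr, mul_one, psdSqrt_mul_self hS.posSemidef]

lemma sqrtCongr_injective {S : Mat n} (hS : S.PosDef) : Function.Injective (sqrtCongr S) := by
  intro Y Z h
  have := congrArg (fun X => (psdSqrt S)⁻¹ * X * (psdSqrt S)⁻¹) h
  have e : ∀ X : Mat n, (psdSqrt S)⁻¹ * sqrtCongr S X * (psdSqrt S)⁻¹ = X := fun X => by
    rw [sqrtCongr, ← mul_assoc, ← mul_assoc, psdSqrt_inv_mul hS, one_mul, mul_assoc,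
      psdSqrt_mul_inv hS, mul_one]
  simpa only [e] using this

lemma det_sqrtCongr {S : Mat n} (hS : S.PosDef) (Y : Mat n) :
    (sqrtCongr S Y).det = S.det * Y.det := by
  conv_rhs => rw [← psdSqrt_mul_self hS.posSemidef]
  simp only [sqrtCongr, Matrix.det_mul]
  ring

lemma trace_sqrtCongr_mul_inv {S : Mat n} (hS : S.PosDef) (Y : Mat n) :
    (sqrtCongr S Y * S⁻¹).trace = Y.trace := by
  rw [inv_eq_psdSqrt_inv_mul hS, sqrtCongr, mul_assoc, ← mul_assoc (psdSqrt S) (psdSqrt S)⁻¹,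
    psdSqrt_mul_inv hS, one_mul, Matrix.trace_mul_cycle, psdSqrt_inv_mul hS, one_mul]

end Root

/-! ### The Kullback-Leibler divergence -/

/-- The value of `gaussianKL` at positive definite matrices. -/
noncomputable def klReal (S S₀ : Mat n) : ℝ :=
  (1 / 2 : ℝ) * (-Real.log S.det + Real.log S₀.det + (S * S₀⁻¹).trace - (n : ℝ))

lemma gaussianKL_of_posDef {S : Mat n} (hS : S.PosDef) (S₀ : Mat n) :
    gaussianKL S S₀ = (klReal S S₀ : EReal) := if_pos hS

lemma mem_ball_iff {S S₀ : Mat n} {ε : ℝ} :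
    S ∈ ball gaussianKL S₀ ε ↔ S.PosDef ∧ klReal S S₀ ≤ ε := by
  constructor
  · rintro ⟨-, h⟩
    have hS : S.PosDef := by
      by_contra hS
      rw [gaussianKL, if_neg hS] at h
      exact EReal.coe_ne_top ε (top_le_iff.1 h)
    rw [gaussianKL_of_posDef hS] at h
    exact ⟨hS, EReal.coe_le_coe_iff.1 h⟩
  · rintro ⟨hS, h⟩
    refine ⟨hS.posSemidef, ?_⟩
    rw [gaussianKL_of_posDef hS]
    exact EReal.coe_le_coe_iff.2 h

lemma klReal_sqrtCongr {S Y : Mat n} (hS : S.PosDef) (hY : Y.PosDef) :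
    klReal (sqrtCongr S Y) S = (1 / 2) * (-Real.log Y.det + Y.trace - n) := by
  rw [klReal, det_sqrtCongr hS, trace_sqrtCongr_mul_inv hS,
    Real.log_mul hS.det_pos.ne' hY.det_pos.ne']
  ring

lemma klReal_sqrtCongr_eq_sum {S Y : Mat n} (hS : S.PosDef) (hY : Y.PosDef) :
    klReal (sqrtCongr S Y) S = (1 / 2) *
      ∑ i, (hY.isHermitian.eigenvalues i - 1 - Real.log (hY.isHermitian.eigenvalues i)) := by
  have hdet := hY.isHermitian.det_eq_prod_eigenvalues
  have htr := hY.isHermitian.trace_eq_sum_eigenvalues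
  simp only [RCLike.ofReal_real_eq_id, id] at hdet htr
  rw [klReal_sqrtCongr hS hY, hdet, htr, Real.log_prod fun i _ => (hY.eigenvalues_pos i).ne']
  simp only [Finset.sum_sub_distrib, Finset.sum_const, Finset.card_univ, Fintype.card_fin,
    nsmul_eq_mul, mul_one]
  ring

lemma sub_one_sub_log_nonneg {x : ℝ} (hx : 0 < x) : 0 ≤ x - 1 - Real.log x :=
  sub_nonneg.2 (Real.log_le_sub_one_of_pos hx)

lemma klReal_nonneg {T S : Mat n} (hT : T.PosDef) (hS : S.PosDef) : 0 ≤ klReal T S := by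
  obtain ⟨Y, rfl⟩ := exists_sqrtCongr_eq hS T
  have hY := (posDef_sqrtCongr_iff hS).1 hT
  rw [klReal_sqrtCongr_eq_sum hS hY]
  exact mul_nonneg (by norm_num)
    (Finset.sum_nonneg fun i _ => sub_one_sub_log_nonneg (hY.eigenvalues_pos i))

lemma eq_of_klReal_eq_zero {T S : Mat n} (hT : T.PosDef) (hS : S.PosDef)
    (h : klReal T S = 0) : T = S := by
  obtain ⟨Y, rfl⟩ := exists_sqrtCongr_eq hS T
  have hY := (posDef_sqrtCongr_iff hS).1 hT
  rw [klReal_sqrtCongr_eq_sum hS hY] at h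
  have h0 := (Finset.sum_eq_zero_iff_of_nonneg
    fun i _ => sub_one_sub_log_nonneg (hY.eigenvalues_pos i)).1
    ((mul_eq_zero.1 h).resolve_left (by norm_num))
  have h1 : hY.isHermitian.eigenvalues = 1 := by
    ext i
    by_contra hne
    have := Real.log_lt_sub_one_of_pos (hY.eigenvalues_pos i) hne
    linarith [h0 i (Finset.mem_univ i)]
  have : Y = 1 := by
    rw [← spectralConj_eigenvalues hY.isHermitian, h1, spectralConj_one]
  rw [this, sqrtCongr_one hS]

lemma klReal_self {S : Mat n} (hS : S.PosDef) : klReal S S = 0 := by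
  have := klReal_sqrtCongr hS (Matrix.PosDef.one (n := Fin n) (R := ℝ))
  rw [sqrtCongr_one hS] at this
  simpa using this

/-- Matrices in the ball lie below a multiple of the centre in the Loewner order. -/
lemma posSemidef_smul_sub_of_klReal_le {T S : Mat n} (hT : T.PosDef) (hS : S.PosDef) {ε : ℝ}
    (h : klReal T S ≤ ε) : ((1 + klRadius ε) • S - T).PosSemidef := by
  obtain ⟨Y, rfl⟩ := exists_sqrtCongr_eq hS T
  have hY := (posDef_sqrtCongr_iff hS).1 hT
  rw [klReal_sqrtCongr_eq_sum hS hY] at h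
  have hle : ∀ i, hY.isHermitian.eigenvalues i ≤ 1 + klRadius ε := fun i => by
    refine le_one_add_klRadius (hY.eigenvalues_pos i) ?_
    have := Finset.single_le_sum
      (fun i _ => sub_one_sub_log_nonneg (hY.eigenvalues_pos i)) (Finset.mem_univ i)
    linarith
  set c := 1 + klRadius ε
  have e : c • S - sqrtCongr S Y = sqrtCongr S (c • 1 - Y) := by
    simp only [sqrtCongr, mul_sub, sub_mul, mul_smul_comm, smul_mul_assoc, mul_one]
    rw [psdSqrt_mul_self hS.posSemidef]
  have e2 : c • 1 - Y =
      spectralConj hY.isHermitian (c • 1 + (-1 : ℝ) • hY.isHermitian.eigenvalues) := by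
    rw [spectralConj_add, spectralConj_smul, spectralConj_smul, spectralConj_one,
      spectralConj_eigenvalues, neg_one_smul, sub_eq_add_neg]
  rw [e, posSemidef_sqrtCongr_iff hS, e2, posSemidef_spectralConj_iff]
  intro i
  have := hle i
  simp
  linarith

/-! ### The linear minimization oracle -/

section Oracle

variable {S₀ L : Mat n}

/-- With `R = S₀^{1/2}`, factor `S₀⁻¹ + (2/γ) L = R⁻¹ (1 + (2/γ) R L R) R⁻¹`; inverting the middle
factor gives `R N R`. -/
lemma inv_add_smul_mul_sqrtCongr (hS₀ : S₀.PosDef) {γ : ℝ} {N : Mat n}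
    (hN : (1 + (2 / γ) • sqrtCongr S₀ L) * N = 1) :
    (S₀⁻¹ + (2 / γ) • L) * sqrtCongr S₀ N = 1 := by
  have h1 := psdSqrt_inv_mul hS₀
  have e : (S₀⁻¹ + (2 / γ) • L) * sqrtCongr S₀ N =
      (psdSqrt S₀)⁻¹ * ((1 + (2 / γ) • sqrtCongr S₀ L) * N) * psdSqrt S₀ := by
    have h2 : ∀ X : Mat n, (psdSqrt S₀)⁻¹ * (psdSqrt S₀ * X) = X := fun X => by
      rw [← mul_assoc, h1, one_mul]
    simp only [sqrtCongr, inv_eq_psdSqrt_inv_mul hS₀, add_mul, mul_add, one_mul, smul_mul_assoc,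
      mul_smul_comm, mul_assoc, h2]
  rw [e, hN, mul_one, h1]

variable {γ : ℝ}

lemma one_add_smul_mul_spectralConj_inv (hM : (sqrtCongr S₀ L).IsHermitian)
    (hγ : ∀ i, 0 < 1 + 2 / γ * hM.eigenvalues i) :
    (1 + (2 / γ) • sqrtCongr S₀ L) *
      spectralConj hM (fun i => (1 + 2 / γ * hM.eigenvalues i)⁻¹) = 1 := by
  rw [← spectralConj_one_add_smul hM, spectralConj_mul]
  have : (fun i => 1 + 2 / γ * hM.eigenvalues i) * (fun i => (1 + 2 / γ * hM.eigenvalues i)⁻¹)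
      = 1 := by
    ext i
    exact mul_inv_cancel₀ (hγ i).ne'
  rw [this, spectralConj_one]

lemma klOracle_eq (hS₀ : S₀.PosDef) (hM : (sqrtCongr S₀ L).IsHermitian)
    (hγ : ∀ i, 0 < 1 + 2 / γ * hM.eigenvalues i) :
    klOracle S₀ L γ =
    sqrtCongr S₀ (spectralConj hM (fun i => (1 + 2 / γ * hM.eigenvalues i)⁻¹)) :=
  Matrix.inv_eq_right_inv
    (inv_add_smul_mul_sqrtCongr hS₀ (one_add_smul_mul_spectralConj_inv hM hγ))

lemma posDef_klOracle (hS₀ : S₀.PosDef) (hM : (sqrtCongr S₀ L).IsHermitian)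
    (hγ : ∀ i, 0 < 1 + 2 / γ * hM.eigenvalues i) :
    (klOracle S₀ L γ).PosDef := by
  rw [klOracle_eq hS₀ hM hγ, posDef_sqrtCongr_iff hS₀, posDef_spectralConj_iff]
  exact fun i => inv_pos.2 (hγ i)

lemma klOracle_inv (hS₀ : S₀.PosDef) (hM : (sqrtCongr S₀ L).IsHermitian)
    (hγ : ∀ i, 0 < 1 + 2 / γ * hM.eigenvalues i) :
    (klOracle S₀ L γ)⁻¹ = S₀⁻¹ + (2 / γ) • L := by
  rw [klOracle_eq hS₀ hM hγ]
  exact Matrix.inv_eq_left_inv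
    (inv_add_smul_mul_sqrtCongr hS₀ (one_add_smul_mul_spectralConj_inv hM hγ))

lemma klReal_klOracle (hS₀ : S₀.PosDef) (hM : (sqrtCongr S₀ L).IsHermitian)
    (hγ : ∀ i, 0 < 1 + 2 / γ * hM.eigenvalues i) :
    klReal (klOracle S₀ L γ) S₀ = scaleKL hM.eigenvalues (2 / γ) := by
  have hN : (spectralConj hM (fun i => (1 + 2 / γ * hM.eigenvalues i)⁻¹)).PosDef :=
    (posDef_spectralConj_iff hM _).2 fun i => inv_pos.2 (hγ i)
  rw [klOracle_eq hS₀ hM hγ, klReal_sqrtCongr hS₀ hN, det_spectralConj, trace_spectralConj,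
    Real.log_prod fun i _ => inv_ne_zero (hγ i).ne']
  simp only [scaleKL, resolventKL, Finset.sum_sub_distrib, Finset.sum_add_distrib,
    Finset.sum_const, Finset.card_univ, Fintype.card_fin, nsmul_eq_mul, mul_one, Real.log_inv,
    Finset.sum_neg_distrib, neg_neg]

/-- The Lagrangian of the linear minimization problem is the divergence from its minimizer, up to
a constant. -/
lemma klReal_add_frobInner (hL : L.IsSymm) {K : Mat n} (hK : K.PosDef)
    (hKinv : K⁻¹ = S₀⁻¹ + (2 / γ) • L) (T : Mat n) :
    klReal T S₀ + γ⁻¹ * frobInner L T = klReal K S₀ + γ⁻¹ * frobInner L K + klReal T K := by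
  have htr : ∀ X : Mat n, (X * K⁻¹).trace = (X * S₀⁻¹).trace + 2 / γ * frobInner L X := fun X => by
    rw [hKinv, mul_add, Matrix.trace_add, mul_smul_comm, Matrix.trace_smul, smul_eq_mul, frobInner,
      hL.eq, Matrix.trace_mul_comm X L]
  -- Here the left side is `n`, which cancels the trace terms and the `-n` in `klReal K S₀ + γ⁻¹⟨L,
  -- K⟩`.
  have h1 := htr K
  rw [Matrix.mul_nonsing_inv _ ((Matrix.isUnit_iff_isUnit_det _).1 hK.isUnit),
    Matrix.trace_one, Fintype.card_fin] at h1
  rw [klReal, klReal, klReal, htr T, div_eq_mul_inv 2 γ]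
  rw [div_eq_mul_inv 2 γ] at h1
  linarith

/-- As `KL(T‖S₀) ≤ ε = KL(K‖S₀)`, the Lagrangian identity yields `γ⁻¹(⟨L, T⟩ - ⟨L, K⟩) ≥ KL(T‖K) ≥
0`; a second minimizer has `KL(T‖K) = 0`. -/
lemma lmo_eq_singleton (hL : L.IsSymm) {K : Mat n} (hK : K.PosDef)
    (hKinv : K⁻¹ = S₀⁻¹ + (2 / γ) • L) (h0 : 0 < γ) {ε : ℝ} (hε : klReal K S₀ = ε) :
    lmo gaussianKL S₀ ε L = {K} := by
  have hKmem : K ∈ ball gaussianKL S₀ ε := mem_ball_iff.2 ⟨hK, hε.le⟩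
  have hinv : 0 < γ⁻¹ := inv_pos.2 h0
  refine Set.eq_singleton_iff_unique_mem.2 ⟨⟨hKmem, fun T hT => ?_⟩, fun T hT => ?_⟩
  · obtain ⟨hTpos, hTε⟩ := mem_ball_iff.1 hT
    have h1 := klReal_add_frobInner hL hK hKinv T
    have h2 := klReal_nonneg hTpos hK
    exact le_of_mul_le_mul_left (by linarith) hinv
  · obtain ⟨hTpos, hTε⟩ := mem_ball_iff.1 hT.1
    have h1 := klReal_add_frobInner hL hK hKinv T
    have h2 := klReal_nonneg hTpos hK
    have h3 := mul_le_mul_of_nonneg_left (hT.2 K hKmem) hinv.le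
    exact eq_of_klReal_eq_zero hTpos hK (by linarith)

end Oracle

lemma eigenvalues_sqrtCongr_ne_zero {S₀ L : Mat n} (hS₀ : S₀.PosDef) (hL : L ≠ 0)
    (hM : (sqrtCongr S₀ L).IsHermitian) : hM.eigenvalues ≠ 0 := by
  intro h
  apply hL
  apply sqrtCongr_injective hS₀
  rw [← spectralConj_eigenvalues hM, h, ← zero_smul ℝ (0 : Fin n → ℝ), spectralConj_smul,
    zero_smul, sqrtCongr, mul_zero, zero_mul]

/-! ### The Frobenius inner product -/

/-- The swapped indices follow the summation order of `Tr (Aᵀ B)`. -/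
lemma frobInner_eq_sum (A B : Mat n) : frobInner A B =
    ∑ p : Fin n × Fin n, A p.2 p.1 * B p.2 p.1 := by
  rw [Fintype.sum_prod_type]
  rfl

lemma frobInner_self_nonneg (A : Mat n) : 0 ≤ frobInner A A := by
  rw [frobInner_eq_sum]
  exact Finset.sum_nonneg fun p _ => mul_self_nonneg _

lemma frobNorm_nonneg (A : Mat n) : 0 ≤ frobNorm A := Real.sqrt_nonneg _

lemma frobNorm_sq (A : Mat n) : frobNorm A ^ 2 = frobInner A A :=
  Real.sq_sqrt (frobInner_self_nonneg A)

lemma frobInner_le (A B : Mat n) : frobInner A B ≤ frobNorm A * frobNorm B := by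
  refine le_of_sq_le_sq ?_ (mul_nonneg (frobNorm_nonneg A) (frobNorm_nonneg B))
  rw [mul_pow, frobNorm_sq, frobNorm_sq, frobInner_eq_sum, frobInner_eq_sum, frobInner_eq_sum]
  simpa only [sq] using Finset.sum_mul_sq_le_sq_mul_sq Finset.univ
    (fun p : Fin n × Fin n => A p.2 p.1) (fun p => B p.2 p.1)

lemma frobInner_sub_left (A B C : Mat n) :
    frobInner (A - B) C = frobInner A C - frobInner B C := by
  rw [frobInner, Matrix.transpose_sub, sub_mul, Matrix.trace_sub, frobInner, frobInner]

lemma frobNorm_sub_comm (A B : Mat n) : frobNorm (A - B) = frobNorm (B - A) := by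
  have : A - B = -(B - A) := (neg_sub B A).symm
  rw [frobNorm, frobNorm, this, frobInner, Matrix.transpose_neg, neg_mul_neg, frobInner]

lemma abs_apply_le_frobNorm (A : Mat n) (i j : Fin n) : |A i j| ≤ frobNorm A := by
  refine Real.abs_le_sqrt ?_
  rw [frobInner_eq_sum, sq]
  exact Finset.single_le_sum (f := fun p : Fin n × Fin n => A p.2 p.1 * A p.2 p.1)
    (fun p _ => mul_self_nonneg _) (Finset.mem_univ (j, i))

lemma continuous_frobInner (L : Mat n) : Continuous (frobInner L) := by
  unfold frobInner
  fun_prop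

lemma continuous_frobNorm : Continuous (frobNorm : Mat n → ℝ) := by
  unfold frobNorm frobInner
  fun_prop

/-- `Tr (A B) = Tr (A^{1/2} B A^{1/2})`, the trace of a positive semidefinite matrix. -/
lemma trace_mul_nonneg {A B : Mat n} (hA : A.PosSemidef) (hB : B.PosSemidef) :
    0 ≤ (A * B).trace := by
  rw [← psdSqrt_mul_self hA, Matrix.trace_mul_cycle]
  have := hB.mul_mul_conjTranspose_same (psdSqrt A)
  rw [(posSemidef_psdSqrt A).isHermitian.eq] at this
  have h := this.trace_nonneg
  rwa [Matrix.trace_mul_cycle, Matrix.trace_mul_cycle] at h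

lemma frobInner_eq_trace_mul {A : Mat n} (hA : A.PosSemidef) (B : Mat n) :
    frobInner A B = (A * B).trace := by
  rw [frobInner, ← Matrix.conjTranspose_eq_transpose_of_trivial, hA.isHermitian.eq]

/-- Pairing `c S - T` with `T` and then with `S` gives `⟨T, T⟩ ≤ c⟨T, S⟩ ≤ c²⟨S, S⟩`. -/
lemma frobNorm_le_of_posSemidef_smul_sub {S T : Mat n} (hS : S.PosSemidef) (hT : T.PosSemidef)
    {c : ℝ} (hc : 0 ≤ c) (h : (c • S - T).PosSemidef) : frobNorm T ≤ c * frobNorm S := by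
  have h1 := trace_mul_nonneg hT h
  have h2 := trace_mul_nonneg hS h
  rw [mul_sub, Matrix.trace_sub, mul_smul_comm, Matrix.trace_smul, smul_eq_mul] at h1 h2
  rw [Matrix.trace_mul_comm S T] at h2
  refine le_of_sq_le_sq ?_ (mul_nonneg hc (frobNorm_nonneg S))
  rw [mul_pow, frobNorm_sq, frobNorm_sq, frobInner_eq_trace_mul hS, frobInner_eq_trace_mul hT]
  have h3 := mul_le_mul_of_nonneg_left (sub_nonneg.1 h2) hc
  nlinarith

/-! ### Compactness of the ball -/

section Ball

variable {S₀ : Mat n} {ε : ℝ}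

lemma center_mem_ball (hS₀ : S₀.PosDef) (hε : 0 ≤ ε) : S₀ ∈ ball gaussianKL S₀ ε :=
  mem_ball_iff.2 ⟨hS₀, (klReal_self hS₀).trans_le hε⟩

lemma frobNorm_le_of_mem_ball {T : Mat n} (hS₀ : S₀.PosDef) (hT : T ∈ ball gaussianKL S₀ ε) :
    frobNorm T ≤ (1 + klRadius ε) * frobNorm S₀ := by
  obtain ⟨hTpos, hTε⟩ := mem_ball_iff.1 hT
  exact frobNorm_le_of_posSemidef_smul_sub hS₀.posSemidef hTpos.posSemidef
    (by linarith [klRadius_nonneg ε]) (posSemidef_smul_sub_of_klReal_le hTpos hS₀ hTε)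

/-- Exponentiating removes the singularity of `log det`: both conditions are closed, and the
positive lower bound on the determinant forces definiteness. -/
lemma ball_eq : ball gaussianKL S₀ ε = {S : Mat n | S.PosSemidef} ∩
    {S | Real.exp (Real.log S₀.det + (S * S₀⁻¹).trace - n - 2 * ε) ≤ S.det} := by
  ext S
  rw [mem_ball_iff]
  have key : ∀ hS : S.PosDef, klReal S S₀ ≤ ε ↔
      Real.exp (Real.log S₀.det + (S * S₀⁻¹).trace - n - 2 * ε) ≤ S.det := fun hS => by
    rw [← Real.le_log_iff_exp_le hS.det_pos, klReal]
    constructor <;> intro h <;> linarith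
  constructor
  · rintro ⟨hS, h⟩
    exact ⟨hS.posSemidef, (key hS).1 h⟩
  · rintro ⟨hS, h⟩
    have hS' : S.PosDef := hS.posDef_iff_det_ne_zero.2 ((Real.exp_pos _).trans_le h).ne'
    exact ⟨hS', (key hS').2 h⟩

lemma isClosed_setOf_posSemidef : IsClosed {S : Mat n | S.PosSemidef} := by
  have : {S : Mat n | S.PosSemidef} = {S | Sᴴ = S} ∩
      ⋂ x : Fin n → ℝ, {S | 0 ≤ star x ⬝ᵥ (S *ᵥ x)} := by
    ext S
    simp [Matrix.posSemidef_iff_dotProduct_mulVec, Matrix.IsHermitian]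
  rw [this]
  refine IsClosed.inter (isClosed_eq (by fun_prop) continuous_id) (isClosed_iInter fun x => ?_)
  exact isClosed_le continuous_const (by fun_prop)

lemma isCompact_ball (hS₀ : S₀.PosDef) : IsCompact (ball gaussianKL S₀ ε) := by
  have hcl : IsClosed (ball gaussianKL S₀ ε) := by
    rw [ball_eq]
    exact isClosed_setOf_posSemidef.inter (isClosed_le (by fun_prop) (by fun_prop))
  set C := (1 + klRadius ε) * frobNorm S₀
  have hK : IsCompact (Set.univ.pi fun _ : Fin n => Set.univ.pi fun _ : Fin n => Set.Icc (-C) C) :=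
    isCompact_univ_pi fun _ => isCompact_univ_pi fun _ => isCompact_Icc
  refine IsCompact.of_isClosed_subset (X := Mat n) hK hcl fun T hT => ?_
  intro i _ j _
  exact abs_le.1 ((abs_apply_le_frobNorm T i j).trans (frobNorm_le_of_mem_ball hS₀ hT))

lemma isLeast_dualFun (hS₀ : S₀.PosDef) (hε : 0 ≤ ε) (L : Mat n) :
    IsLeast (frobInner L '' ball gaussianKL S₀ ε) (dualFun gaussianKL S₀ ε L) :=
  ((isCompact_ball hS₀).image (continuous_frobInner L)).isLeast_sInf
    (Set.Nonempty.image _ ⟨S₀, center_mem_ball hS₀ hε⟩)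

lemma isGreatest_lipConst (hS₀ : S₀.PosDef) (hε : 0 ≤ ε) :
    IsGreatest (frobNorm '' ball gaussianKL S₀ ε) (lipConst gaussianKL S₀ ε) :=
  ((isCompact_ball hS₀).image continuous_frobNorm).isGreatest_sSup
    (Set.Nonempty.image _ ⟨S₀, center_mem_ball hS₀ hε⟩)

/-- A minimizer `T` for `L₂` is a competitor for `L₁`, so the difference is at most `⟨L₁ - L₂, T⟩`.
-/
lemma dualFun_sub_le (hS₀ : S₀.PosDef) (hε : 0 ≤ ε) (L₁ L₂ : Mat n) :
    dualFun gaussianKL S₀ ε L₁ - dualFun gaussianKL S₀ ε L₂ ≤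
      lipConst gaussianKL S₀ ε * frobNorm (L₁ - L₂) := by
  obtain ⟨T, hT, hTe⟩ := (isLeast_dualFun hS₀ hε L₂).1
  have h1 := (isLeast_dualFun hS₀ hε L₁).2 ⟨T, hT, rfl⟩
  have h2 := (isGreatest_lipConst hS₀ hε).2 ⟨T, hT, rfl⟩
  have h3 := frobInner_le (L₁ - L₂) T
  rw [frobInner_sub_left] at h3
  have h4 := mul_le_mul_of_nonneg_left h2 (frobNorm_nonneg (L₁ - L₂))
  rw [← hTe]
  linarith

lemma abs_dualFun_sub_le (hS₀ : S₀.PosDef) (hε : 0 ≤ ε) (L₁ L₂ : Mat n) :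
    |dualFun gaussianKL S₀ ε L₁ - dualFun gaussianKL S₀ ε L₂| ≤
      lipConst gaussianKL S₀ ε * frobNorm (L₁ - L₂) := by
  refine abs_sub_le_iff.2 ⟨dualFun_sub_le hS₀ hε L₁ L₂, ?_⟩
  rw [frobNorm_sub_comm]
  exact dualFun_sub_le hS₀ hε L₂ L₁

lemma lipConst_le (hS₀ : S₀.PosDef) (hε : 0 ≤ ε) :
    lipConst gaussianKL S₀ ε ≤ (n * klRadius ε + 1) * frobNorm S₀ := by
  obtain ⟨T, hT, hTe⟩ := (isGreatest_lipConst hS₀ hε).1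
  rw [← hTe]
  refine (frobNorm_le_of_mem_ball hS₀ hT).trans ?_
  -- The factor `1 + r` is at most `n r + 1` only for `n ≥ 1` in general; for `n = 0` the norm
  -- vanishes.
  rcases Nat.eq_zero_or_pos n with rfl | hn
  · have : frobNorm S₀ = 0 := by simp [frobNorm, frobInner]
    rw [this, mul_zero, mul_zero]
  · have h1 : (1 : ℝ) ≤ n := by exact_mod_cast hn
    refine mul_le_mul_of_nonneg_right ?_ (frobNorm_nonneg S₀)
    nlinarith [klRadius_nonneg ε]

end Ball

lemma exists_unique_multiplier {S₀ L : Mat n} (hS₀ : S₀.PosDef) {ε : ℝ} (hε : 0 < ε)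
    (hL : L.IsSymm) (hL0 : L ≠ 0) :
    ∃ γ : ℝ, max 0 (2 * lambdaMax (-sqrtCongr S₀ L)) < γ ∧
      γ ≤ nuclearNorm (sqrtCongr S₀ L) * multiplierFactor ε ∧
      gaussianKL (klOracle S₀ L γ) S₀ = (ε : EReal) ∧
      lmo gaussianKL S₀ ε L = {klOracle S₀ L γ} ∧
      ∀ γ' : ℝ, max 0 (2 * lambdaMax (-sqrtCongr S₀ L)) < γ' →
        gaussianKL (klOracle S₀ L γ') S₀ = (ε : EReal) → γ' = γ := by
  have hM := isHermitian_sqrtCongr S₀ hL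
  have hμ := eigenvalues_sqrtCongr_ne_zero hS₀ hL0 hM
  obtain ⟨j, -⟩ := Function.ne_iff.1 hμ
  have : Nonempty (Fin n) := ⟨j⟩
  have hN := sum_abs_pos hμ
  have hc : 0 < multiplierFactor ε := by linarith [(multiplierFactor_bounds hε).1]
  obtain ⟨hadm, hle⟩ := scaleKL_le_of_multiplierFactor hμ hε
  obtain ⟨s, hs, hsadm, hseq⟩ := exists_scaleKL_eq hμ hε (by positivity) hadm hle
  have hspos : 0 < s := lt_of_lt_of_le (by positivity) hs
  have h2s : 2 / (2 / s) = s := by field_simp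
  have hγ : 0 < 2 / s := by positivity
  have hadm' : ∀ i, 0 < 1 + 2 / (2 / s) * hM.eigenvalues i := by rwa [h2s]
  have hkl : klReal (klOracle S₀ L (2 / s)) S₀ = ε := by
    rw [klReal_klOracle hS₀ hM hadm', h2s, hseq]
  have hpd := posDef_klOracle hS₀ hM hadm'
  refine ⟨2 / s, (max_lambdaMax_neg_lt_iff hM).2 ⟨hγ, hadm'⟩, ?_, ?_,
    lmo_eq_singleton hL hpd (klOracle_inv hS₀ hM hadm') hγ hkl, ?_⟩
  · rw [nuclearNorm_eq_sum_abs hM, div_le_iff₀ hspos, mul_comm, ← div_le_iff₀ (by positivity)]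
    exact hs
  · rw [gaussianKL_of_posDef hpd, hkl]
  · intro γ' hγ' h
    obtain ⟨h0, hadm''⟩ := (max_lambdaMax_neg_lt_iff hM).1 hγ'
    rw [gaussianKL_of_posDef (posDef_klOracle hS₀ hM hadm''), klReal_klOracle hS₀ hM hadm'',
      EReal.coe_eq_coe_iff] at h
    have hs' : 0 < 2 / γ' := by positivity
    have : 2 / γ' = s := by
      rcases lt_trichotomy (2 / γ') s with hlt | heq | hlt
      · linarith [scaleKL_lt hμ hs' hlt hsadm]
      · exact heq
      · linarith [scaleKL_lt hμ hspos hlt hadm'']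
    rw [← this]
    field_simp

end FactorModel

theorem mainTheorem5 (n : ℕ) (S₀ : Matrix (Fin n) (Fin n) ℝ) (hS₀ : S₀.PosDef) (ε : ℝ) :
    -- closed-form description of the oracle
    (0 < ε → ∀ L : Matrix (Fin n) (Fin n) ℝ, L.IsSymm → L ≠ 0 →
      ∃ γ : ℝ,
        max 0 (2 * FactorModel.lambdaMax (-FactorModel.sqrtCongr S₀ L)) < γ ∧
        γ ≤ FactorModel.nuclearNorm (FactorModel.sqrtCongr S₀ L) *
            (if ε ≤ 1 / 24 then √(6 / ε) else 6 + 1 / (4 * ε)) ∧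
        FactorModel.gaussianKL (FactorModel.klOracle S₀ L γ) S₀ = (ε : EReal) ∧
        FactorModel.lmo FactorModel.gaussianKL S₀ ε L = {FactorModel.klOracle S₀ L γ} ∧
        ∀ γ' : ℝ, max 0 (2 * FactorModel.lambdaMax (-FactorModel.sqrtCongr S₀ L)) < γ' →
          FactorModel.gaussianKL (FactorModel.klOracle S₀ L γ') S₀ = (ε : EReal) → γ' = γ) ∧
    -- Lipschitz constant of the dual function
    (0 ≤ ε →
      (∀ L : Matrix (Fin n) (Fin n) ℝ, L.IsSymm →
        IsLeast (FactorModel.frobInner L '' FactorModel.ball FactorModel.gaussianKL S₀ ε)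
          (FactorModel.dualFun FactorModel.gaussianKL S₀ ε L)) ∧
      IsGreatest (FactorModel.frobNorm '' FactorModel.ball FactorModel.gaussianKL S₀ ε)
        (FactorModel.lipConst FactorModel.gaussianKL S₀ ε) ∧
      (∀ L₁ L₂ : Matrix (Fin n) (Fin n) ℝ, L₁.IsSymm → L₂.IsSymm →
        |FactorModel.dualFun FactorModel.gaussianKL S₀ ε L₁ -
            FactorModel.dualFun FactorModel.gaussianKL S₀ ε L₂| ≤
          FactorModel.lipConst FactorModel.gaussianKL S₀ ε * FactorModel.frobNorm (L₁ - L₂)) ∧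
      FactorModel.lipConst FactorModel.gaussianKL S₀ ε ≤
        ((n : ℝ) * (if ε ≤ 1 / 24 then √(6 * ε) else 6 * ε + 1 / 4) + 1) *
          FactorModel.frobNorm S₀) := by
  exact ⟨fun hε _ hL hL0 => FactorModel.exists_unique_multiplier hS₀ hε hL hL0,
    fun hε => ⟨fun L _ => FactorModel.isLeast_dualFun hS₀ hε L,
      FactorModel.isGreatest_lipConst hS₀ hε,
      fun L₁ L₂ _ _ => FactorModel.abs_dualFun_sub_le hS₀ hε L₁ L₂,
      FactorModel.lipConst_le hS₀ hε⟩⟩
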